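/- Let $b\in\mathbb R$, $c\ge 0$, let $m$ be a measure on $(0,\infty)$ with $\int_{(0,\infty)}(u\wedge u^2)\,m(du)<\infty$, and put $$\phi(z)=bz+cz^2+\int_{(0,\infty)}(e^{-zu}-1+zu)\,m(du),\qquad z\ge 0.$$ For $\lambda\ge 0$ let $t\mapsto v_t(\lambda)$ be the unique locally bounded nonnegative solution of $v_t(\lambda)=\lambda-\int_0^t\phi(v_s(\lambda))\,ds$, $t\ge 0$. Let $(x(t))_{t\ge 0}$, with probability laws $(\mathbf Q_x)_{x\ge 0}$, be a càdlàg realization of the continuous-state branching process with branching mechanism $\phi$, that is, a càdlàg $[0,\infty)$-valued Markov process with $\mathbf Q_x\{x(0)=x\}=1$ and with transition semigroup $(Q_t)_{t\ge 0}$ given by $$\int_{[0,\infty)}e^{-\lambda y}\,Q_t(x,dy)=e^{-xv_t(\lambda)},\qquad \lambda,x,t\ge 0,$$ and let $\tau_0=\inf\{s\ge 0: x(s)=0\}$ (with $\inf\emptyset=\infty$). We say that Grey's condition holds if there is some $\theta>0$ such that $\phi(z)>0$ for all $z\ge\theta$ and $\int_\theta^\infty\phi(z)^{-1}\,dz<\infty$.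 For every $t\ge 0$ the function $\lambda\mapsto v_t(\lambda)$ is increasing on $[0,\infty)$, so that the limit $\bar v_t=\lim_{\lambda\to\infty}v_t(\lambda)\in[0,\infty]$ exists; the map $t\mapsto\bar v_t$ is decreasing, and $\bar v=\lim_{t\to\infty}\bar v_t\in[0,\infty]$ exists. Moreover: (i) For every $x>0$, $\mathbf Q_x\{\tau_0<\infty\}=\exp\{-x\bar v\}$, where $\exp\{-\infty\}=0$. (ii) $\bar v_t<\infty$ for some $t>0$ if and only if Grey's condition holds, and in this case $\bar v_t<\infty$ for all $t>0$. (iii) $\bar v<\infty$ if and only if Grey's condition holds, and in this case $\bar v$ is the largest root of $\phi(z)=0$ in $[0,\infty)$. -/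

import Mathlib

open Set Filter Topology MeasureTheory ProbabilityTheory
open scoped NNReal ENNReal

noncomputable section

/-- The data of a branching mechanism: constants `b ∈ ℝ`, `c ≥ 0` and a measure `m` on `(0, ∞)`
such that `(u ∧ u²) m(du)` is a finite measure on `(0, ∞)`. Only the restriction of `m` to
`(0, ∞)` is ever used. -/
structure BranchingMechanism where
  b : ℝ
  c : ℝ
  c_nonneg : 0 ≤ c
  m : Measure ℝ
  finite_m : ∫⁻ u in Ioi (0 : ℝ), ENNReal.ofReal (min u (u ^ 2)) ∂m < ⊤

namespace BranchingMechanism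

/-- The function `φ(z) = b z + c z² + ∫_{(0,∞)} (e^{-zu} - 1 + zu) m(du)`, meant for `z ≥ 0`. -/
def phi (ψ : BranchingMechanism) (z : ℝ) : ℝ :=
  ψ.b * z + ψ.c * z ^ 2 + ∫ u in Ioi (0 : ℝ), (Real.exp (-(z * u)) - 1 + z * u) ∂ψ.m

/-- `w : [0, ∞) → [0, ∞)` is a locally bounded positive solution of
`w(t) = l - ∫₀ᵗ φ(w(s)) ds`, `t ≥ 0`. The values of `w` at negative times are irrelevant. -/
structure IsCumulantSolution (ψ : BranchingMechanism) (l : ℝ) (w : ℝ → ℝ) : Prop where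
  nonneg : ∀ t, 0 ≤ t → 0 ≤ w t
  locally_bounded : ∀ T, 0 ≤ T → BddAbove (w '' Icc 0 T)
  integrable : ∀ t, 0 ≤ t → IntervalIntegrable (fun s => ψ.phi (w s)) volume 0 t
  equation : ∀ t, 0 ≤ t → w t = l - ∫ s in (0 : ℝ)..t, ψ.phi (w s)

open Classical in
/-- The cumulant semigroup: `t ↦ ψ.cumulant t l` is the locally bounded positive solution with
initial value `l` (for `t, l ≥ 0`, where it exists and is unique). -/
def cumulant (ψ : BranchingMechanism) (t l : ℝ) : ℝ :=
  if h : ∃ w : ℝ → ℝ, ψ.IsCumulantSolution l w then h.choose t else 0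

/-- Grey's condition: for some `θ > 0`, `φ(z) > 0` for `z ≥ θ` and `∫_θ^∞ φ(z)⁻¹ dz < ∞`. -/
def GreyCondition (ψ : BranchingMechanism) : Prop :=
  ∃ θ : ℝ, 0 < θ ∧ (∀ z, θ ≤ z → 0 < ψ.phi z) ∧
    IntegrableOn (fun z => (ψ.phi z)⁻¹) (Ici θ) volume

/-- `(P_t)_{t ≥ 0}` are the transition probabilities on `[0, ∞)` of the CB-process:
`∫ e^{-l y} P_t(x, dy) = e^{-x v_t(l)}` for all `l, x, t ≥ 0`. -/
structure IsTransitionSemigroup (ψ : BranchingMechanism) (P : ℝ≥0 → Kernel ℝ≥0 ℝ≥0) : Prop where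
  isMarkovKernel : ∀ t, IsMarkovKernel (P t)
  laplace : ∀ (t x : ℝ≥0) (l : ℝ), 0 ≤ l →
    ∫ y, Real.exp (-(l * y)) ∂(P t x) = Real.exp (-(x * ψ.cumulant t l))

/-- `(Ω, ℱ, ℱ_t, X_t, Q_x)` is a càdlàg realization of the CB-process with branching mechanism
`ψ`: an adapted `[0, ∞)`-valued process which, under each probability measure `Q_x`, starts
from `x`, has càdlàg paths and is a Markov process relative to `(ℱ_t)` with the transition
semigroup `(P_t)` of the CB-process. -/
structure IsCBRealization (ψ : BranchingMechanism) {Ω : Type*} {mΩ : MeasurableSpace Ω}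
    (ℱ : Filtration ℝ≥0 mΩ) (X : ℝ≥0 → Ω → ℝ≥0) (Q : ℝ≥0 → Measure Ω)
    (P : ℝ≥0 → Kernel ℝ≥0 ℝ≥0) : Prop where
  semigroup : ψ.IsTransitionSemigroup P
  isProbabilityMeasure : ∀ x, IsProbabilityMeasure (Q x)
  adapted : ∀ t, Measurable[ℱ t] (X t)
  start : ∀ x, ∀ᵐ ω ∂(Q x), X 0 ω = x
  cadlag : ∀ x, ∀ᵐ ω ∂(Q x), ∀ t : ℝ≥0,
    ContinuousWithinAt (fun s => X s ω) (Ici t) t ∧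
      ∃ l : ℝ≥0, Tendsto (fun s => X s ω) (𝓝[<] t) (𝓝 l)
  markov : ∀ (x s t : ℝ≥0) (B : Set ℝ≥0), MeasurableSet B →
    (Q x)[(X (s + t) ⁻¹' B).indicator (fun _ => (1 : ℝ)) | ℱ s]
      =ᵐ[Q x] fun ω => (P t (X s ω)).real B

end BranchingMechanism

/-- The extinction time `τ₀ = inf {s ≥ 0 : X_s = 0}`, with `inf ∅ = ∞`. -/
def extinctionTime {Ω : Type*} (X : ℝ≥0 → Ω → ℝ≥0) (ω : Ω) : ℝ≥0∞ :=
  sInf ((fun s : ℝ≥0 => (s : ℝ≥0∞)) '' {s | X s ω = 0})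

end

/-!
The function `φ` is locally Lipschitz on `[0, ∞)` with `φ(0) = 0` and `φ(z) ≥ b z`, so the cumulant
equation is the autonomous scalar equation `w' = -φ(w)`, which has a unique global solution from
every `l ≥ 0` (`exists_isCumulantSolution`, `IsFlowLine.eqOn`). Uniqueness makes solutions monotone
in `l` and gives the flow property `v_{s+t}(l) = v_t(v_s(l))`, and hence the monotonicity of `v̄_t`
in `t`.

A level with `φ > 0` can only be crossed downwards, and a solution started where `φ ≤ 0` never falls
below its initial value. Separation of variables (`IsFlowLine.integral_inv_phi`) then says that the
travel time from `∞` down to `a` is `∫_a^∞ dz / φ(z)`. If this is finite, every `v_t(l)` with `t`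
larger is at most `a` (`cumulant_le_of_integral_inv_phi_lt`); conversely a bound on `v_t(l)` uniform
in `l` bounds the integral by `t` (`greyCondition_of_cumulant_le`). The same comparison shows that
`φ(v̄) > 0` is impossible, so `v̄` is the largest root (`isGreatest_extinctionRate`). Convexity of
`φ` is not needed.

For the extinction probability, `l → ∞` in the Laplace transform gives
`P_t(x, {0}) = exp (-x v̄_t)`, so it remains to see that `0` is absorbing for the process at real, not only at fixed, times. Under
the Markov property `s ↦ 1 - exp (-X_s v_{T-s}(1))` is a nonnegative martingale on `[0, T]`. A
maximal inequality over finite sets of times (`withDensity_biUnion_le`) and right-continuity of the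
paths show that `1 - exp (-X_T)` vanishes almost surely if `X` hits `0` before `T`
(`ae_eq_zero_of_lt`). So extinction is, up to a null set, the increasing union of the events
`X_n = 0`.
-/

namespace BranchingMechanism

/-! ### Regularity of the branching mechanism -/

lemma integrand_nonneg (z u : ℝ) : 0 ≤ Real.exp (-(z * u)) - 1 + z * u := by
  linarith [Real.add_one_le_exp (-(z * u))]

/-- The `z`-derivative `u (1 - e^{-zu})` of the integrand is at most `(1 + R) (u ∧ u²)` for
`z ≤ R`, which makes `φ` Lipschitz on `[0, R]`. -/
lemma abs_integrand_sub_le {R z w u : ℝ} (hz : z ∈ Icc 0 R) (hw : w ∈ Icc 0 R) (hu : 0 < u) :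
    |(Real.exp (-(z * u)) - 1 + z * u) - (Real.exp (-(w * u)) - 1 + w * u)|
      ≤ (1 + R) * min u (u ^ 2) * |z - w| := by
  wlog h : w ≤ z generalizing z w
  · rw [abs_sub_comm, abs_sub_comm z w]
    exact this hw hz (le_of_not_ge h)
  have hzw : 0 ≤ z - w := sub_nonneg.2 h
  -- `e^{-zu} - e^{-wu}` lies between `-e^{-wu} (z - w) u` and `0`
  have h1 : Real.exp (-(z * u)) ≤ Real.exp (-(w * u)) :=
    Real.exp_le_exp.2 (by nlinarith)
  have h2 : Real.exp (-(w * u)) * (1 - (z - w) * u) ≤ Real.exp (-(z * u)) := by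
    have e : Real.exp (-(z * u)) = Real.exp (-(w * u)) * Real.exp (-((z - w) * u)) := by
      rw [← Real.exp_add]; ring_nf
    rw [e]
    exact mul_le_mul_of_nonneg_left (by linarith [Real.add_one_le_exp (-((z - w) * u))])
      (Real.exp_pos _).le
  have h1' : Real.exp (-(w * u)) - Real.exp (-(z * u)) ≤ (z - w) * u := by
    have : Real.exp (-(w * u)) ≤ 1 := Real.exp_le_one_iff.2 (by nlinarith [hw.1])
    nlinarith [mul_nonneg hzw hu.le]
  have h3 : 1 - z * u ≤ Real.exp (-(z * u)) := by
    linarith [Real.add_one_le_exp (-(z * u))]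
  have hR : 0 ≤ R := hz.1.trans hz.2
  -- the sharper upper bound `-e^{-zu} (z - w) u` for the same difference
  have h4 : Real.exp (-(z * u)) * (1 + (z - w) * u) ≤ Real.exp (-(w * u)) := by
    have e : Real.exp (-(w * u)) = Real.exp (-(z * u)) * Real.exp ((z - w) * u) := by
      rw [← Real.exp_add]; ring_nf
    rw [e]
    exact mul_le_mul_of_nonneg_left (by linarith [Real.add_one_le_exp ((z - w) * u)])
      (Real.exp_pos _).le
  have hd : 0 ≤ (z - w) * u := mul_nonneg hzw hu.le
  rw [abs_of_nonneg hzw, abs_of_nonneg (by linarith)]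
  rcases le_total u (u ^ 2) with h5 | h5
  · rw [min_eq_left h5]
    nlinarith [mul_nonneg hR hd]
  · rw [min_eq_right h5]
    have h6 : (z - w) * u * (1 - Real.exp (-(z * u))) ≤ (z - w) * u * (R * u) :=
      mul_le_mul_of_nonneg_left (by nlinarith [hz.2]) hd
    nlinarith [mul_nonneg hd hu.le]

variable (ψ : BranchingMechanism)

lemma integrable_min : IntegrableOn (fun u : ℝ => min u (u ^ 2)) (Ioi 0) ψ.m := by
  refine ⟨(by fun_prop : Continuous fun u : ℝ => min u (u ^ 2)).aestronglyMeasurable, ?_⟩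
  rw [hasFiniteIntegral_iff_ofReal]
  · exact ψ.finite_m
  · filter_upwards [ae_restrict_mem measurableSet_Ioi] with u hu
    exact le_min (le_of_lt hu) (sq_nonneg u)

lemma integrable_integrand {z : ℝ} (hz : 0 ≤ z) :
    IntegrableOn (fun u : ℝ => Real.exp (-(z * u)) - 1 + z * u) (Ioi 0) ψ.m := by
  refine ((ψ.integrable_min.const_mul (1 + z)).mul_const |z - 0|).mono'
    (by fun_prop : Continuous fun u : ℝ => Real.exp (-(z * u)) - 1 + z * u).aestronglyMeasurable ?_
  filter_upwards [ae_restrict_mem measurableSet_Ioi] with u hu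
  simpa using abs_integrand_sub_le (R := z) ⟨hz, le_rfl⟩ ⟨le_rfl, hz⟩ hu

lemma phi_zero : ψ.phi 0 = 0 := by simp [phi]

lemma b_mul_le_phi (z : ℝ) : ψ.b * z ≤ ψ.phi z := by
  have h1 : 0 ≤ ∫ u in Ioi (0 : ℝ), (Real.exp (-(z * u)) - 1 + z * u) ∂ψ.m :=
    integral_nonneg fun u => integrand_nonneg z u
  have h2 := mul_nonneg ψ.c_nonneg (sq_nonneg z)
  unfold phi
  linarith

lemma exists_lipschitzOnWith_phi (R : ℝ) : ∃ K : ℝ≥0, LipschitzOnWith K ψ.phi (Icc 0 R) := by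
  rcases lt_or_ge R 0 with hR | hR
  · exact ⟨0, by simp [Icc_eq_empty_of_lt hR]⟩
  set I := ∫ u in Ioi (0 : ℝ), min u (u ^ 2) ∂ψ.m
  refine ⟨(|ψ.b| + ψ.c * (2 * R) + (1 + R) * I).toNNReal, LipschitzOnWith.of_dist_le_mul ?_⟩
  intro z hz w hw
  rw [Real.dist_eq, Real.dist_eq]
  refine le_trans ?_ (mul_le_mul_of_nonneg_right (Real.le_coe_toNNReal _) (abs_nonneg _))
  have e : ψ.phi z - ψ.phi w = ψ.b * (z - w) + ψ.c * (z + w) * (z - w) +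
      ∫ u in Ioi (0 : ℝ), ((Real.exp (-(z * u)) - 1 + z * u) -
        (Real.exp (-(w * u)) - 1 + w * u)) ∂ψ.m := by
    rw [integral_sub (ψ.integrable_integrand hz.1) (ψ.integrable_integrand hw.1)]
    unfold phi
    ring
  have h3 : |∫ u in Ioi (0 : ℝ), ((Real.exp (-(z * u)) - 1 + z * u) -
        (Real.exp (-(w * u)) - 1 + w * u)) ∂ψ.m| ≤ (1 + R) * I * |z - w| := by
    rw [← integral_const_mul, ← integral_mul_const, ← Real.norm_eq_abs]
    refine norm_integral_le_of_norm_le ((ψ.integrable_min.const_mul (1 + R)).mul_const _) ?_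
    filter_upwards [ae_restrict_mem measurableSet_Ioi] with u hu
    exact abs_integrand_sub_le hz hw hu
  have h2 : |ψ.c * (z + w) * (z - w)| ≤ ψ.c * (2 * R) * |z - w| := by
    rw [abs_mul, abs_of_nonneg (mul_nonneg ψ.c_nonneg (add_nonneg hz.1 hw.1))]
    have := ψ.c_nonneg
    have : z + w ≤ 2 * R := by linarith [hz.2, hw.2]
    gcongr
  rw [e]
  calc _ ≤ |ψ.b * (z - w)| + |ψ.c * (z + w) * (z - w)| + _ := abs_add_three _ _ _
    _ ≤ |ψ.b| * |z - w| + ψ.c * (2 * R) * |z - w| + (1 + R) * I * |z - w| := by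
        rw [abs_mul ψ.b]; gcongr
    _ = _ := by ring

lemma continuousOn_phi : ContinuousOn ψ.phi (Ici 0) := by
  intro z hz
  obtain ⟨K, hK⟩ := ψ.exists_lipschitzOnWith_phi (z + 1)
  refine (hK.continuousOn z ⟨hz, by linarith⟩).mono_of_mem_nhdsWithin ?_
  have : Iic (z + 1) ∈ 𝓝 z := Iic_mem_nhds (by linarith)
  filter_upwards [self_mem_nhdsWithin, mem_nhdsWithin_of_mem_nhds this] with y h1 h2
  exact ⟨h1, h2⟩

end BranchingMechanism

namespace BranchingMechanism

/-! ### The differential equation `w' = -φ(w)` -/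

/-- `w` is a nonnegative continuous solution of the differential equation `w' = -φ(w)` on `[0, T]`,
the derivative being a right derivative. This is the differential form of
`BranchingMechanism.IsCumulantSolution`, and it leaves the initial value free. -/
structure IsFlowLine (ψ : BranchingMechanism) (w : ℝ → ℝ) (T : ℝ) : Prop where
  nonneg : ∀ t ∈ Icc 0 T, 0 ≤ w t
  continuousOn : ContinuousOn w (Icc 0 T)
  deriv : ∀ t ∈ Ico 0 T, HasDerivWithinAt w (-ψ.phi (w t)) (Ici t) t

variable {ψ : BranchingMechanism} {w w₁ w₂ : ℝ → ℝ} {T S s t a : ℝ}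

namespace IsFlowLine

lemma mono (hw : ψ.IsFlowLine w T) (hS : S ≤ T) : ψ.IsFlowLine w S where
  nonneg t ht := hw.nonneg t ⟨ht.1, ht.2.trans hS⟩
  continuousOn := hw.continuousOn.mono (Icc_subset_Icc_right hS)
  deriv t ht := hw.deriv t ⟨ht.1, ht.2.trans_le hS⟩

lemma congr (hw : ψ.IsFlowLine w₁ T) (h : EqOn w₂ w₁ (Icc 0 T)) : ψ.IsFlowLine w₂ T where
  nonneg t ht := by rw [h ht]; exact hw.nonneg t ht
  continuousOn := hw.continuousOn.congr h
  deriv t ht := by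
    rw [h ⟨ht.1, ht.2.le⟩]
    refine (hw.deriv t ht).congr_of_eventuallyEq ?_ (h ⟨ht.1, ht.2.le⟩)
    filter_upwards [self_mem_nhdsWithin, mem_nhdsWithin_of_mem_nhds (Iio_mem_nhds ht.2)]
      with r h1 h2
    exact h ⟨ht.1.trans h1, le_of_lt h2⟩

lemma shift (hw : ψ.IsFlowLine w T) (hs : 0 ≤ s) : ψ.IsFlowLine (fun t => w (s + t)) (T - s) where
  nonneg t ht := hw.nonneg _ ⟨by linarith [ht.1], by linarith [ht.2]⟩
  continuousOn := hw.continuousOn.comp (by fun_prop) fun t ht =>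
    ⟨by linarith [ht.1], by linarith [ht.2]⟩
  deriv t ht := by
    have h1 := hw.deriv (s + t) ⟨by linarith [ht.1], by linarith [ht.2]⟩
    have h2 : HasDerivWithinAt (fun t => s + t) 1 (Ici t) t :=
      ((hasDerivAt_id t).const_add s).hasDerivWithinAt
    have h3 : MapsTo (fun t => s + t) (Ici t) (Ici (s + t)) := fun r hr => add_le_add_right hr s
    simpa [Function.comp_def] using h1.comp t h2 h3

lemma eqOn (h₁ : ψ.IsFlowLine w₁ T) (h₂ : ψ.IsFlowLine w₂ T) (h0 : w₁ 0 = w₂ 0) :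
    EqOn w₁ w₂ (Icc 0 T) := by
  obtain ⟨R₁, hR₁⟩ := isCompact_Icc.bddAbove_image h₁.continuousOn
  obtain ⟨R₂, hR₂⟩ := isCompact_Icc.bddAbove_image h₂.continuousOn
  obtain ⟨K, hK⟩ := ψ.exists_lipschitzOnWith_phi (max R₁ R₂)
  refine ODE_solution_unique_of_mem_Icc_right (v := fun _ z => -ψ.phi z)
    (s := fun _ => Icc 0 (max R₁ R₂)) (K := K) (fun t _ => ?_) h₁.continuousOn h₁.deriv
    (fun t ht => ?_) h₂.continuousOn h₂.deriv (fun t ht => ?_) h0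
  · intro x hx y hy
    rw [edist_neg_neg]
    exact hK hx hy
  · exact ⟨h₁.nonneg t ⟨ht.1, ht.2.le⟩,
      (hR₁ (mem_image_of_mem _ ⟨ht.1, ht.2.le⟩)).trans (le_max_left _ _)⟩
  · exact ⟨h₂.nonneg t ⟨ht.1, ht.2.le⟩,
      (hR₂ (mem_image_of_mem _ ⟨ht.1, ht.2.le⟩)).trans (le_max_right _ _)⟩

/-- Two solutions that cross coincide from the crossing on, so their order is preserved. -/
lemma le_of_le (h₁ : ψ.IsFlowLine w₁ T) (h₂ : ψ.IsFlowLine w₂ T) (h0 : w₁ 0 ≤ w₂ 0)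
    (ht : t ∈ Icc 0 T) : w₁ t ≤ w₂ t := by
  by_contra! hlt
  have hsub : Icc 0 t ⊆ Icc 0 T := Icc_subset_Icc_right ht.2
  obtain ⟨s, hs, hs0⟩ : (0 : ℝ) ∈ (fun r => w₁ r - w₂ r) '' Icc 0 t :=
    intermediate_value_Icc ht.1 ((h₁.continuousOn.sub h₂.continuousOn).mono hsub)
      ⟨sub_nonpos.2 h0, (sub_pos.2 hlt).le⟩
  have := (h₁.shift hs.1).eqOn (h₂.shift hs.1) (by simpa using sub_eq_zero.1 hs0)
    (x := t - s) ⟨by linarith [hs.2], by linarith [ht.2]⟩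
  simp only [add_sub_cancel] at this
  exact hlt.ne' this

/-- A level `a` with `φ(a) > 0` can only be crossed downwards. -/
lemma le_of_phi_pos (hw : ψ.IsFlowLine w T) (ha : 0 < ψ.phi a) (h0 : w 0 ≤ a)
    (ht : t ∈ Icc 0 T) : w t ≤ a :=
  image_le_of_deriv_right_lt_deriv_boundary hw.continuousOn hw.deriv h0
    (fun x => hasDerivAt_const x a) (fun x _ hx => by rw [hx]; linarith) ht

lemma lt_of_phi_pos (hw : ψ.IsFlowLine w T) (ha : 0 < ψ.phi a) (ht : t ∈ Icc 0 T) (hta : a < w t)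
    (hs : s ∈ Icc 0 t) : a < w s := by
  by_contra! h
  have := (hw.shift hs.1).le_of_phi_pos (t := t - s) ha (by simpa using h)
    ⟨by linarith [hs.2], by linarith [ht.2]⟩
  simp only [add_sub_cancel] at this
  linarith

lemma const (ha : 0 ≤ a) (h : ψ.phi a = 0) : ψ.IsFlowLine (fun _ => a) T where
  nonneg _ _ := ha
  continuousOn := continuousOn_const
  deriv t _ := by simpa [h] using hasDerivWithinAt_const t (Ici t) a

lemma ge_of_phi_nonpos (hw : ψ.IsFlowLine w T) (h : ψ.phi (w 0) ≤ 0) (ht : t ∈ Icc 0 T) :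
    w 0 ≤ w t := by
  rcases h.lt_or_eq with h | h
  · exact image_le_of_deriv_right_lt_deriv_boundary' (f' := fun _ => 0) continuousOn_const
      (fun x _ => hasDerivWithinAt_const x _ (w 0)) le_rfl hw.continuousOn hw.deriv
      (fun x _ hx => by rw [← hx]; linarith) ht
  · have h0 : 0 ≤ w 0 := hw.nonneg 0 ⟨le_rfl, ht.1.trans ht.2⟩
    exact (IsFlowLine.const h0 h).le_of_le hw le_rfl ht

/-- Separation of variables: the time spent between two levels is the integral of `1/φ`. -/
lemma integral_inv_phi (hw : ψ.IsFlowLine w T) (hT : 0 ≤ T)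
    (hpos : ∀ t ∈ Icc 0 T, 0 < ψ.phi (w t)) :
    ∫ z in w T..w 0, (ψ.phi z)⁻¹ = T := by
  have hmaps : MapsTo w (Icc 0 T) (Ici 0) := hw.nonneg
  have hc : ContinuousOn (fun t => -ψ.phi (w t)) (Icc 0 T) :=
    (ψ.continuousOn_phi.comp hw.continuousOn hmaps).neg
  have key := intervalIntegral.integral_comp_mul_deriv'' (a := 0) (b := T) (f := w)
    (f' := fun t => -ψ.phi (w t)) (g := fun z => (ψ.phi z)⁻¹)
    (by rw [uIcc_of_le hT]; exact hw.continuousOn)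
    (fun t ht => by
      rw [min_eq_left hT, max_eq_right hT] at ht
      exact (hw.deriv t ⟨ht.1.le, ht.2⟩).mono Ioi_subset_Ici_self)
    (by rw [uIcc_of_le hT]; exact hc)
    (by
      rw [uIcc_of_le hT]
      refine (ψ.continuousOn_phi.mono hmaps.image_subset).inv₀ ?_
      rintro _ ⟨t, ht, rfl⟩
      exact (hpos t ht).ne')
  rw [intervalIntegral.integral_symm, ← key]
  have : ∫ t in (0 : ℝ)..T, ((fun z => (ψ.phi z)⁻¹) ∘ w) t * -ψ.phi (w t) =
      ∫ t in (0 : ℝ)..T, -1 := by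
    refine intervalIntegral.integral_congr fun t ht => ?_
    rw [uIcc_of_le hT] at ht
    have := (hpos t ht).ne'
    simp only [Function.comp_apply]
    field_simp
  rw [this]
  simp

end IsFlowLine

/-- Solutions exist on every `[0, T]`: Picard–Lindelöf is applied to `φ` clamped to `[0, R]` with
`R = l e^{|b| T}`, which the solution cannot leave because of `φ(0) = 0` and `φ(z) ≥ b z`. -/
lemma exists_isFlowLine (ψ : BranchingMechanism) {l : ℝ} (hl : 0 ≤ l) (hT : 0 ≤ T) :
    ∃ w, w 0 = l ∧ ψ.IsFlowLine w T := by
  set R := l * Real.exp (|ψ.b| * T)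
  have hR : 0 ≤ R := by positivity
  obtain ⟨K, hK⟩ := ψ.exists_lipschitzOnWith_phi R
  set c : ℝ → ℝ := fun x => projIcc 0 R hR x
  have hc : LipschitzWith 1 c := by
    simpa [c, Function.comp_def] using
      (LipschitzWith.subtype_val (Icc 0 R)).comp (LipschitzWith.projIcc hR)
  have hcm : ∀ x, c x ∈ Icc 0 R := fun x => (projIcc 0 R hR x).2
  have hF : LipschitzWith K fun x => -ψ.phi (c x) := by
    intro x y
    rw [edist_neg_neg]
    refine (hK (hcm x) (hcm y)).trans ?_
    gcongr
    simpa using hc x y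
  obtain ⟨L, hL⟩ := isCompact_Icc.exists_bound_of_continuousOn hK.continuousOn
  have hL0 : 0 ≤ L := (norm_nonneg _).trans (hL 0 ⟨le_rfl, hR⟩)
  have hPL : IsPicardLindelof (fun _ x => -ψ.phi (c x)) (tmin := 0) (tmax := T)
      ⟨0, le_rfl, hT⟩ l (L.toNNReal * T.toNNReal) 0 L.toNNReal K :=
    { lipschitzOnWith := fun _ _ => hF.lipschitzOnWith
      continuousOn := fun _ _ => continuousOn_const
      norm_le := fun _ _ x _ => by
        rw [norm_neg]
        exact (hL _ (hcm x)).trans (Real.le_coe_toNNReal L)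
      mul_max_le := by simp [hT] }
  obtain ⟨w, hw0, hw⟩ := hPL.exists_eq_forall_mem_Icc_hasDerivWithinAt₀
  simp only at hw0
  have hcont : ContinuousOn w (Icc 0 T) := fun t ht => (hw t ht).continuousWithinAt
  have hder : ∀ t ∈ Ico 0 T, HasDerivWithinAt w (-ψ.phi (c (w t))) (Ici t) t := fun t ht =>
    (hw t ⟨ht.1, ht.2.le⟩).mono_of_mem_nhdsWithin (Icc_mem_nhdsGE_of_mem ht)
  have hnn : ∀ t ∈ Icc 0 T, 0 ≤ w t := by
    intro t ht
    -- the line `-ε t` is a lower barrier for every `ε > 0`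
    have key : ∀ ε > 0, -ε * t ≤ w t := fun ε hε =>
      image_le_of_deriv_right_lt_deriv_boundary' (f := fun t => -ε * t) (f' := fun _ => -ε)
        (by fun_prop)
        (fun x _ => by simpa using ((hasDerivAt_id x).const_mul (-ε)).hasDerivWithinAt)
        (by simpa [hw0] using hl) hcont hder
        (fun x hx h => by
          have : c (w x) = 0 := by
            have : w x ≤ 0 := by rw [← h]; nlinarith [hx.1]
            simp [c, projIcc_of_le_left hR this]
          simpa [this, ψ.phi_zero] using hε) ht
    have hlim : Tendsto (fun ε : ℝ => -ε * t) (𝓝[>] 0) (𝓝 0) := by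
      have : Tendsto (fun ε : ℝ => -ε * t) (𝓝 0) (𝓝 (-0 * t)) :=
        (by fun_prop : Continuous fun ε : ℝ => -ε * t).tendsto 0
      simpa using this.mono_left nhdsWithin_le_nhds
    exact le_of_tendsto hlim (by filter_upwards [self_mem_nhdsWithin] with ε hε using key ε hε)
  have hle : ∀ t ∈ Icc 0 T, w t ≤ R := by
    intro t ht
    have h1 := le_gronwallBound_of_liminf_deriv_right_le (δ := l) (K := |ψ.b|) (ε := 0) hcont
      (fun x hx _ hr => (hder x hx).liminf_right_slope_le hr) hw0.le
      (fun x hx => by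
        have hx' := hnn x ⟨hx.1, hx.2.le⟩
        have h2 : c (w x) ≤ w x := by
          simp only [c, coe_projIcc]
          exact max_le hx' (min_le_right _ _)
        have h3 := ψ.b_mul_le_phi (c (w x))
        have h4 := (hcm (w x)).1
        nlinarith [neg_abs_le ψ.b, abs_nonneg ψ.b]) t ht
    rw [gronwallBound_ε0, sub_zero] at h1
    refine h1.trans (mul_le_mul_of_nonneg_left (Real.exp_le_exp.2 ?_) hl)
    exact mul_le_mul_of_nonneg_left ht.2 (abs_nonneg _)
  refine ⟨w, hw0, hnn, hcont, fun t ht => ?_⟩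
  have h := hder t ht
  have ht' : t ∈ Icc 0 T := ⟨ht.1, ht.2.le⟩
  rwa [show c (w t) = w t by simp [c, projIcc_of_mem hR ⟨hnn t ht', hle t ht'⟩]] at h

end BranchingMechanism

namespace BranchingMechanism

/-! ### The cumulant semigroup -/

variable {ψ : BranchingMechanism} {w : ℝ → ℝ} {l s t a z : ℝ}

lemma IsCumulantSolution.initial (hw : ψ.IsCumulantSolution l w) : w 0 = l := by
  simpa using hw.equation 0 le_rfl

lemma IsCumulantSolution.isFlowLine (hw : ψ.IsCumulantSolution l w) (T : ℝ) :
    ψ.IsFlowLine w T := by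
  have hcont : ContinuousOn w (Icc 0 T) := by
    rcases lt_or_ge T 0 with hT | hT
    · simp [Icc_eq_empty_of_lt hT]
    have h1 := intervalIntegral.continuousOn_primitive_interval'
      (hw.integrable T hT) (a := 0) left_mem_uIcc
    rw [uIcc_of_le hT] at h1
    exact (continuousOn_const.sub h1).congr fun t ht => hw.equation t ht.1
  refine ⟨fun t ht => hw.nonneg t ht.1, hcont, fun t ht => ?_⟩
  have hφ : ContinuousOn (fun s => ψ.phi (w s)) (Icc 0 T) :=
    ψ.continuousOn_phi.comp hcont fun s hs => hw.nonneg s hs.1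
  have hmem : Icc 0 T ∈ 𝓝[≥] t := Icc_mem_nhdsGE_of_mem ht
  have hmem' : Icc 0 T ∈ 𝓝[>] t := nhdsWithin_mono t Ioi_subset_Ici_self hmem
  have ht' : t ∈ Icc 0 T := ⟨ht.1, ht.2.le⟩
  have hD := (intervalIntegral.integral_hasDerivWithinAt_right (hw.integrable t ht.1)
    (s := Ici t) (t := Ioi t)
    ⟨Icc 0 T, hmem', hφ.aestronglyMeasurable measurableSet_Icc⟩
    ((hφ t ht').mono_of_mem_nhdsWithin hmem')).const_sub l
  exact hD.congr (fun r hr => hw.equation r (ht.1.trans hr)) (hw.equation t ht.1)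

lemma isCumulantSolution_of_isFlowLine (hw : ∀ T, 0 ≤ T → ψ.IsFlowLine w T) :
    ψ.IsCumulantSolution (w 0) w := by
  have hc : ∀ T, 0 ≤ T → ContinuousOn (fun s => ψ.phi (w s)) (Icc 0 T) := fun T hT =>
    ψ.continuousOn_phi.comp (hw T hT).continuousOn (hw T hT).nonneg
  have hi : ∀ T, 0 ≤ T → IntervalIntegrable (fun s => ψ.phi (w s)) volume 0 T := fun T hT =>
    ContinuousOn.intervalIntegrable (by rw [uIcc_of_le hT]; exact hc T hT)
  refine ⟨fun t ht => (hw t ht).nonneg t ⟨ht, le_rfl⟩,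
    fun T hT => isCompact_Icc.bddAbove_image (hw T hT).continuousOn, hi, fun t ht => ?_⟩
  have h1 := intervalIntegral.integral_eq_sub_of_hasDeriv_right_of_le ht (hw t ht).continuousOn
    (fun x hx => ((hw t ht).deriv x ⟨hx.1.le, hx.2⟩).mono Ioi_subset_Ici_self) (hi t ht).neg
  rw [intervalIntegral.integral_neg] at h1
  linarith

/-- The solutions on the intervals `[0, T]` agree where they overlap, so their diagonal
`t ↦ W_t(t)` solves the equation on `[0, ∞)`. -/
lemma exists_isCumulantSolution (ψ : BranchingMechanism) (hl : 0 ≤ l) :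
    ∃ w, ψ.IsCumulantSolution l w := by
  choose! W hW0 hW using fun (T : ℝ) (hT : 0 ≤ T) => ψ.exists_isFlowLine hl hT
  have h : ∀ T, 0 ≤ T → ψ.IsFlowLine (fun t => W t t) T := fun T hT =>
    (hW T hT).congr fun t ht => (hW t ht.1).eqOn ((hW T hT).mono ht.2)
      (by rw [hW0 t ht.1, hW0 T hT]) ⟨ht.1, le_rfl⟩
  have := isCumulantSolution_of_isFlowLine h
  rw [hW0 0 le_rfl] at this
  exact ⟨_, this⟩

lemma isCumulantSolution_cumulant (ψ : BranchingMechanism) (hl : 0 ≤ l) :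
    ψ.IsCumulantSolution l (fun t => ψ.cumulant t l) := by
  have h := ψ.exists_isCumulantSolution hl
  simp only [cumulant, dif_pos h]
  exact h.choose_spec

lemma isFlowLine_cumulant (ψ : BranchingMechanism) (hl : 0 ≤ l) (T : ℝ) :
    ψ.IsFlowLine (fun t => ψ.cumulant t l) T :=
  (ψ.isCumulantSolution_cumulant hl).isFlowLine T

lemma cumulant_zero (hl : 0 ≤ l) : ψ.cumulant 0 l = l :=
  (ψ.isCumulantSolution_cumulant hl).initial

/-- There is no nonnegative solution from `l < 0`, so `cumulant` takes its default value `0`. -/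
lemma cumulant_of_neg (hl : l < 0) : ψ.cumulant t l = 0 := by
  rw [cumulant, dif_neg]
  rintro ⟨w, hw⟩
  exact absurd (hw.nonneg 0 le_rfl) (by rw [hw.initial]; linarith)

lemma cumulant_nonneg (ht : 0 ≤ t) : 0 ≤ ψ.cumulant t l := by
  rcases lt_or_ge l 0 with hl | hl
  · rw [cumulant_of_neg hl]
  · exact (ψ.isCumulantSolution_cumulant hl).nonneg t ht

lemma monotone_cumulant (ht : 0 ≤ t) : Monotone fun l => ψ.cumulant t l := by
  intro l k hlk
  rcases lt_or_ge l 0 with hl | hl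
  · simpa [cumulant_of_neg hl] using cumulant_nonneg ht
  · have hk := hl.trans hlk
    exact (ψ.isFlowLine_cumulant hl t).le_of_le (ψ.isFlowLine_cumulant hk t)
      (by simpa [cumulant_zero, hl, hk]) ⟨ht, le_rfl⟩

lemma cumulant_add (hs : 0 ≤ s) (ht : 0 ≤ t) (hl : 0 ≤ l) :
    ψ.cumulant (s + t) l = ψ.cumulant t (ψ.cumulant s l) := by
  have hl' : 0 ≤ ψ.cumulant s l := cumulant_nonneg hs
  have h1 := (ψ.isFlowLine_cumulant hl (s + t)).shift hs
  rw [add_sub_cancel_left] at h1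
  exact h1.eqOn (ψ.isFlowLine_cumulant hl' t) (by simp [cumulant_zero hl']) ⟨ht, le_rfl⟩

lemma le_cumulant_of_phi_nonpos (hz : 0 ≤ z) (h : ψ.phi z ≤ 0) (ht : 0 ≤ t) :
    z ≤ ψ.cumulant t z := by
  have := (ψ.isFlowLine_cumulant hz t).ge_of_phi_nonpos (t := t)
    (by simpa [cumulant_zero hz]) ⟨ht, le_rfl⟩
  simpa [cumulant_zero hz] using this

/-! ### Coming down from infinity -/

/-- The travel time from `∞` down to `a` is `∫_a^∞ dz / φ(z)`: after any longer time, solutions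
from all initial values are below `a`. -/
lemma cumulant_le_of_integral_inv_phi_lt (hpos : ∀ z, a ≤ z → 0 < ψ.phi z)
    (hint : IntegrableOn (fun z => (ψ.phi z)⁻¹) (Ici a)) (ht : ∫ z in Ioi a, (ψ.phi z)⁻¹ < t)
    (hl : 0 ≤ l) : ψ.cumulant t l ≤ a := by
  have hnn : 0 ≤ᵐ[volume.restrict (Ioi a)] fun z => (ψ.phi z)⁻¹ := by
    filter_upwards [ae_restrict_mem measurableSet_Ioi] with z hz
    exact (inv_pos.2 (hpos z (le_of_lt hz))).le
  have ht0 : 0 ≤ t := (integral_nonneg_of_ae hnn).trans ht.le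
  by_contra! h
  have hw := ψ.isFlowLine_cumulant hl t
  have habove : ∀ r ∈ Icc 0 t, a < ψ.cumulant r l := fun r hr =>
    hw.lt_of_phi_pos (hpos a le_rfl) ⟨ht0, le_rfl⟩ h hr
  have key := hw.integral_inv_phi ht0 fun r hr => hpos _ (habove r hr).le
  have hsub : uIoc (ψ.cumulant t l) (ψ.cumulant 0 l) ⊆ Ioi a := fun z hz =>
    (lt_min (habove t ⟨ht0, le_rfl⟩) (habove 0 ⟨le_rfl, ht0⟩)).trans hz.1
  have hle : ∫ z in uIoc (ψ.cumulant t l) (ψ.cumulant 0 l), (ψ.phi z)⁻¹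
      ≤ ∫ z in Ioi a, (ψ.phi z)⁻¹ :=
    setIntegral_mono_set (hint.mono_set Ioi_subset_Ici_self) hnn hsub.eventuallyLE
  have habs := intervalIntegral.abs_integral_eq_abs_integral_uIoc
    (a := ψ.cumulant t l) (b := ψ.cumulant 0 l) (f := fun z => (ψ.phi z)⁻¹) (μ := volume)
  have hnn' : 0 ≤ ∫ z in uIoc (ψ.cumulant t l) (ψ.cumulant 0 l), (ψ.phi z)⁻¹ :=
    setIntegral_nonneg measurableSet_uIoc fun z hz => (inv_pos.2 (hpos z (le_of_lt (hsub hz)))).le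
  rw [key, abs_of_nonneg ht0, abs_of_nonneg hnn'] at habs
  linarith

/-- A solution started from a large `l` reaches the level `θ` before time `t`, so that
`∫_θ^l dz / φ(z) ≤ t` uniformly in `l`. -/
lemma greyCondition_of_cumulant_le (ht : 0 ≤ t) {M : ℝ} (hM : ∀ l, 0 ≤ l → ψ.cumulant t l ≤ M) :
    ψ.GreyCondition := by
  have hM0 : 0 ≤ M := (cumulant_nonneg ht).trans (hM 0 le_rfl)
  have hpos : ∀ z, M < z → 0 < ψ.phi z := by
    intro z hz
    by_contra! h
    have hz0 := hM0.trans hz.le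
    linarith [le_cumulant_of_phi_nonpos hz0 h ht, hM z hz0]
  set θ := M + 1
  have hθ : M < θ := by simp [θ]
  refine ⟨θ, by positivity, fun z hz => hpos z (hθ.trans_le hz), ?_⟩
  have hcont : ContinuousOn (fun z => (ψ.phi z)⁻¹) (Ici θ) :=
    (ψ.continuousOn_phi.mono (Ici_subset_Ici.2 (hM0.trans hθ.le))).inv₀
      fun z hz => (hpos z (hθ.trans_le hz)).ne'
  rw [integrableOn_Ici_iff_integrableOn_Ioi]
  refine integrableOn_Ioi_of_intervalIntegral_norm_bounded (l := atTop) (b := fun l : ℝ => l) t θ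
    (fun l => ((hcont.mono Icc_subset_Ici_self).integrableOn_Icc).mono_set Ioc_subset_Icc_self)
    tendsto_id ?_
  filter_upwards [eventually_gt_atTop θ] with l hl
  have hl0 : 0 ≤ l := by linarith
  have hw := ψ.isFlowLine_cumulant hl0 t
  -- the first hitting time of `θ`
  have hcomp : IsCompact (Icc 0 t ∩ (fun r => ψ.cumulant r l) ⁻¹' {θ}) :=
    isCompact_Icc.of_isClosed_subset
      (hw.continuousOn.preimage_isClosed_of_isClosed isClosed_Icc isClosed_singleton)
      inter_subset_left
  have hne : ∀ r ∈ Icc 0 t, ψ.cumulant r l ≤ θ → ∃ q ∈ Icc 0 r, ψ.cumulant q l = θ := by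
    intro r hr hrθ
    exact intermediate_value_Icc' hr.1 (hw.continuousOn.mono (Icc_subset_Icc_right hr.2))
      ⟨hrθ, by simpa [cumulant_zero hl0] using hl.le⟩
  obtain ⟨q, hq, hqθ⟩ := hne t ⟨ht, le_rfl⟩ ((hM l hl0).trans hθ.le)
  obtain ⟨s, ⟨hs, hsθ : ψ.cumulant s l = θ⟩, hmin⟩ := hcomp.exists_isLeast ⟨q, hq, hqθ⟩
  have habove : ∀ r ∈ Icc 0 s, θ ≤ ψ.cumulant r l := by
    intro r hr
    by_contra! h
    have hrt : r ≤ t := hr.2.trans hs.2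
    obtain ⟨q, hq, hqθ⟩ := hne r ⟨hr.1, hrt⟩ h.le
    have hsq := hmin ⟨⟨hq.1, hq.2.trans hrt⟩, hqθ⟩
    have : r = s := le_antisymm hr.2 (hsq.trans hq.2)
    rw [this, hsθ] at h
    exact lt_irrefl _ h
  have key := (hw.mono hs.2).integral_inv_phi hs.1
    fun r hr => hpos _ (hθ.trans_le (habove r hr))
  simp only [hsθ, cumulant_zero hl0] at key
  calc ∫ z in θ..l, ‖(ψ.phi z)⁻¹‖ = ∫ z in θ..l, (ψ.phi z)⁻¹ := by
        refine intervalIntegral.integral_congr fun z hz => ?_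
        rw [uIcc_of_le hl.le] at hz
        exact Real.norm_of_nonneg (inv_pos.2 (hpos z (hθ.trans_le hz.1))).le
    _ ≤ t := key ▸ hs.2

lemma GreyCondition.exists_cumulant_le (h : ψ.GreyCondition) (ht : 0 < t) :
    ∃ M, ∀ l, 0 ≤ l → ψ.cumulant t l ≤ M := by
  obtain ⟨θ, -, hpos, hint⟩ := h
  have htail : Tendsto (fun a => ∫ z in Ioi a, (ψ.phi z)⁻¹) atTop (𝓝 0) := by
    have h1 := intervalIntegral_tendsto_integral_Ioi θ
      (hint.mono_set Ioi_subset_Ici_self) tendsto_id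
    have h2 := (tendsto_const_nhds (x := ∫ z in Ioi θ, (ψ.phi z)⁻¹)).sub h1
    rw [sub_self] at h2
    refine h2.congr' ?_
    filter_upwards [eventually_ge_atTop θ] with a ha
    rw [sub_eq_iff_eq_add', id, intervalIntegral.integral_of_le ha,
      ← setIntegral_union (Ioc_disjoint_Ioi le_rfl) measurableSet_Ioi
        (hint.mono_set (Ioc_subset_Icc_self.trans Icc_subset_Ici_self))
        (hint.mono_set (Ioi_subset_Ici ha)), Ioc_union_Ioi_eq_Ioi ha]
  obtain ⟨a, ha1, ha2⟩ :=
    ((htail.eventually (gt_mem_nhds ht)).and (eventually_ge_atTop θ)).exists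
  exact ⟨a, fun l hl => cumulant_le_of_integral_inv_phi_lt (fun z hz => hpos z (ha2.trans hz))
    (hint.mono_set (Ici_subset_Ici.2 ha2)) ha1 hl⟩

/-! ### The limits of the cumulant semigroup -/

/-- The limit `v̄_t = lim_{l → ∞} v_t(l)`, as the supremum over all `l`. Negative `l` contribute
nothing, since `cumulant` vanishes there. -/
noncomputable def cumulantLimit (ψ : BranchingMechanism) (t : ℝ) : ℝ≥0∞ :=
  ⨆ l : ℝ, ENNReal.ofReal (ψ.cumulant t l)

/-- The limit `v̄ = lim_{t → ∞} v̄_t`, as an infimum. -/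
noncomputable def extinctionRate (ψ : BranchingMechanism) : ℝ≥0∞ :=
  ⨅ t : ℝ≥0, ψ.cumulantLimit t

lemma tendsto_ofReal_cumulant (ht : 0 ≤ t) :
    Tendsto (fun l => ENNReal.ofReal (ψ.cumulant t l)) atTop (𝓝 (ψ.cumulantLimit t)) :=
  tendsto_atTop_iSup fun _ _ h => ENNReal.ofReal_le_ofReal (monotone_cumulant ht h)

lemma ofReal_cumulant_le (t l : ℝ) : ENNReal.ofReal (ψ.cumulant t l) ≤ ψ.cumulantLimit t :=
  le_iSup (fun l => ENNReal.ofReal (ψ.cumulant t l)) l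

/-- By the flow property, `v̄_{s+t} = sup_l v_t(v_s(l)) ≤ v̄_t`. -/
lemma antitoneOn_cumulantLimit (ψ : BranchingMechanism) : AntitoneOn ψ.cumulantLimit (Ici 0) := by
  intro t ht s hs hts
  refine iSup_le fun l => ?_
  rcases lt_or_ge l 0 with hl | hl
  · simp [cumulant_of_neg hl]
  · have := cumulant_add (ψ := ψ) (sub_nonneg.2 hts) ht hl
    rw [sub_add_cancel] at this
    rw [this]
    exact ofReal_cumulant_le t _

lemma antitone_cumulantLimit_coe (ψ : BranchingMechanism) :
    Antitone fun t : ℝ≥0 => ψ.cumulantLimit t := fun s t h =>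
  ψ.antitoneOn_cumulantLimit s.2 t.2 (NNReal.coe_le_coe.2 h)

lemma tendsto_cumulantLimit_coe (ψ : BranchingMechanism) :
    Tendsto (fun t : ℝ≥0 => ψ.cumulantLimit t) atTop (𝓝 ψ.extinctionRate) :=
  tendsto_atTop_iInf ψ.antitone_cumulantLimit_coe

lemma tendsto_cumulantLimit (ψ : BranchingMechanism) :
    Tendsto ψ.cumulantLimit atTop (𝓝 ψ.extinctionRate) := by
  refine (ψ.tendsto_cumulantLimit_coe.comp Real.tendsto_toNNReal_atTop).congr' ?_
  filter_upwards [eventually_ge_atTop 0] with t ht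
  simp [Real.coe_toNNReal t ht]

lemma cumulantLimit_lt_top_iff (ht : 0 ≤ t) :
    ψ.cumulantLimit t < ⊤ ↔ ∃ M, ∀ l, 0 ≤ l → ψ.cumulant t l ≤ M := by
  constructor
  · intro h
    refine ⟨(ψ.cumulantLimit t).toReal, fun l _ => ?_⟩
    rw [← ENNReal.toReal_ofReal (cumulant_nonneg ht)]
    exact ENNReal.toReal_mono h.ne (ofReal_cumulant_le t l)
  · rintro ⟨M, hM⟩
    refine lt_of_le_of_lt (iSup_le fun l => ENNReal.ofReal_le_ofReal (p := _) (q := M) ?_)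
      ENNReal.ofReal_lt_top
    rcases lt_or_ge l 0 with hl | hl
    · rw [cumulant_of_neg hl]
      exact (cumulant_nonneg ht).trans (hM 0 le_rfl)
    · exact hM l hl

lemma GreyCondition.cumulantLimit_lt_top (h : ψ.GreyCondition) (ht : 0 < t) :
    ψ.cumulantLimit t < ⊤ :=
  (cumulantLimit_lt_top_iff ht.le).2 (h.exists_cumulant_le ht)

lemma greyCondition_of_cumulantLimit_lt_top (ht : 0 ≤ t) (h : ψ.cumulantLimit t < ⊤) :
    ψ.GreyCondition :=
  let ⟨_, hM⟩ := (cumulantLimit_lt_top_iff ht).1 h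
  greyCondition_of_cumulant_le ht hM

lemma extinctionRate_lt_top_iff : ψ.extinctionRate < ⊤ ↔ ψ.GreyCondition := by
  constructor
  · intro h
    obtain ⟨t, ht⟩ := iInf_lt_iff.1 h
    exact greyCondition_of_cumulantLimit_lt_top t.2 ht
  · intro h
    exact (iInf_le _ 1).trans_lt (h.cumulantLimit_lt_top (by simp))

/-- If `φ > 0` on `[a, ∞)` then Grey's condition makes `∫_a^∞ dz / φ(z)` finite, because `1/φ` is
continuous on the compact part that remains. -/
lemma GreyCondition.integrableOn_Ici (h : ψ.GreyCondition) (ha : 0 ≤ a)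
    (hpos : ∀ z, a ≤ z → 0 < ψ.phi z) : IntegrableOn (fun z => (ψ.phi z)⁻¹) (Ici a) := by
  obtain ⟨θ, -, -, hint⟩ := h
  have hcont : ContinuousOn (fun z => (ψ.phi z)⁻¹) (Icc a θ) :=
    (ψ.continuousOn_phi.mono (Icc_subset_Ici_self.trans (Ici_subset_Ici.2 ha))).inv₀
      fun z hz => (hpos z hz.1).ne'
  exact (hcont.integrableOn_Icc.union hint).mono_set fun z hz =>
    (le_total z θ).imp (fun h => ⟨hz, h⟩) id

/-- A root `z` of `φ` is a stationary point, so `v̄ ≥ z`. Above `v̄` solutions decrease, so `φ > 0`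
there. If `φ(v̄)` were positive, then so would be `φ` on `[a, ∞)` for some `a < v̄`, and all
solutions would be below `a` after a finite time. -/
lemma isGreatest_extinctionRate (h : ψ.GreyCondition) :
    IsGreatest {z : ℝ | 0 ≤ z ∧ ψ.phi z = 0} ψ.extinctionRate.toReal := by
  have hfin := (extinctionRate_lt_top_iff.2 h).ne
  set q := ψ.extinctionRate.toReal
  have hq0 : 0 ≤ q := ENNReal.toReal_nonneg
  have hq : ENNReal.ofReal q = ψ.extinctionRate := ENNReal.ofReal_toReal hfin
  have hlower : ∀ z, 0 ≤ z → ψ.phi z ≤ 0 → z ≤ q := by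
    intro z hz hφ
    refine (ENNReal.ofReal_le_ofReal_iff hq0).1 (hq ▸ le_iInf fun t => ?_)
    exact (ENNReal.ofReal_le_ofReal (le_cumulant_of_phi_nonpos hz hφ t.2)).trans
      (ofReal_cumulant_le _ z)
  have hpos : ∀ z, q < z → 0 < ψ.phi z := by
    intro z hz
    by_contra! hφ
    exact absurd (hlower z (hq0.trans hz.le) hφ) (not_le.2 hz)
  refine ⟨⟨hq0, ?_⟩, fun z hz => hlower z hz.1 hz.2.le⟩
  by_contra hne
  have hφq : 0 < ψ.phi q := by
    refine lt_of_le_of_ne ?_ (Ne.symm hne)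
    have hc : Tendsto ψ.phi (𝓝[>] q) (𝓝 (ψ.phi q)) :=
      (ψ.continuousOn_phi q hq0).mono_left
        (nhdsWithin_mono q fun z (hz : q < z) => hq0.trans hz.le)
    exact ge_of_tendsto hc (by filter_upwards [self_mem_nhdsWithin] with z hz using (hpos z hz).le)
  have hq1 : 0 < q := by
    refine lt_of_le_of_ne hq0 fun h0 => hne ?_
    rw [← h0, ψ.phi_zero]
  have hnear : ∀ᶠ z in 𝓝 q, 0 < ψ.phi z :=
    (ψ.continuousOn_phi.continuousAt (Ici_mem_nhds hq1)).eventually (lt_mem_nhds hφq)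
  obtain ⟨δ, hδ, hball⟩ := Metric.eventually_nhds_iff.1 hnear
  set a := max 0 (q - δ / 2)
  have ha0 : 0 ≤ a := le_max_left _ _
  have haq : a < q := max_lt hq1 (by linarith)
  have hapos : ∀ z, a ≤ z → 0 < ψ.phi z := by
    intro z hz
    rcases le_or_gt z q with hzq | hzq
    · refine hball ?_
      rw [Real.dist_eq, abs_sub_comm, abs_of_nonneg (sub_nonneg.2 hzq)]
      linarith [(le_max_right 0 (q - δ / 2)).trans hz]
    · exact hpos z hzq
  obtain ⟨t, ht⟩ := exists_gt (max 0 (∫ z in Ioi a, (ψ.phi z)⁻¹))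
  have ht0 : 0 ≤ t := (le_max_left _ _).trans ht.le
  have hle : ψ.cumulantLimit t ≤ ENNReal.ofReal a := by
    refine iSup_le fun l => ENNReal.ofReal_le_ofReal ?_
    rcases lt_or_ge l 0 with hl | hl
    · rwa [cumulant_of_neg hl]
    · exact cumulant_le_of_integral_inv_phi_lt hapos (h.integrableOn_Ici ha0 hapos)
        ((le_max_right _ _).trans_lt ht) hl
  have := (iInf_le (fun t : ℝ≥0 => ψ.cumulantLimit t) ⟨t, ht0⟩).trans hle
  change ψ.extinctionRate ≤ _ at this
  rw [← hq, ENNReal.ofReal_le_ofReal_iff ha0] at this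
  linarith

end BranchingMechanism

namespace BranchingMechanism

/-! ### The transition probabilities at zero -/

variable {ψ : BranchingMechanism} {P : ℝ≥0 → Kernel ℝ≥0 ℝ≥0}

lemma IsTransitionSemigroup.lintegral_one_sub_exp_le (hP : ψ.IsTransitionSemigroup P)
    (t x : ℝ≥0) :
    ∫⁻ y, ENNReal.ofReal (1 - Real.exp (-y)) ∂(P t x) ≤ ENNReal.ofReal (x * ψ.cumulant t 1) := by
  have := hP.isMarkovKernel t
  have hint : Integrable (fun y : ℝ≥0 => Real.exp (-(y : ℝ))) (P t x) := by
    refine (integrable_const (1 : ℝ)).mono' (by fun_prop) (ae_of_all _ fun y => ?_)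
    simp
  have hL := hP.laplace t x 1 zero_le_one
  simp only [one_mul] at hL
  rw [← ofReal_integral_eq_lintegral_ofReal (f := fun y : ℝ≥0 => 1 - Real.exp (-(y : ℝ)))
    ((integrable_const 1).sub hint) (ae_of_all _ fun y => by simp),
    integral_sub (integrable_const 1) hint, hL]
  refine ENNReal.ofReal_le_ofReal ?_
  simp only [integral_const, probReal_univ, smul_eq_mul, one_mul]
  linarith [Real.add_one_le_exp (-(x * ψ.cumulant t 1))]

lemma continuous_exp_neg_coe : Continuous fun a : ℝ≥0∞ => EReal.exp (-(a : EReal)) :=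
  ENNReal.continuous_exp.comp (continuous_neg.comp continuous_coe_ennreal_ereal)

/-- `P_t(x, {0}) = lim_{l → ∞} ∫ e^{-ly} P_t(x, dy)`. -/
lemma IsTransitionSemigroup.apply_singleton_zero (hP : ψ.IsTransitionSemigroup P) (t x : ℝ≥0) :
    P t x {0} = EReal.exp (-(((x : ℝ≥0∞) * ψ.cumulantLimit t : ℝ≥0∞) : EReal)) := by
  have := hP.isMarkovKernel t
  have h1 : Tendsto (fun n : ℕ => ∫ y, Real.exp (-((n : ℝ) * (y : ℝ≥0))) ∂(P t x)) atTop
      (𝓝 (∫ y, ({0} : Set ℝ≥0).indicator (fun _ => (1 : ℝ)) y ∂(P t x))) := by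
    refine tendsto_integral_of_dominated_convergence (fun _ => 1) (fun n => by fun_prop)
      (integrable_const 1) (fun n => ae_of_all _ fun y => ?_) (ae_of_all _ fun y => ?_)
    · rw [Real.norm_of_nonneg (Real.exp_pos _).le]
      exact Real.exp_le_one_iff.2 (neg_nonpos.2 (by positivity))
    · rcases eq_or_ne y 0 with rfl | hy
      · simp
      · have hy' : (0 : ℝ) < y := NNReal.coe_pos.2 (pos_iff_ne_zero.2 hy)
        simp only [mem_singleton_iff, hy, not_false_eq_true, indicator_of_notMem]
        exact Real.tendsto_exp_neg_atTop_nhds_zero.comp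
          (tendsto_natCast_atTop_atTop.atTop_mul_const hy')
  rw [integral_indicator_const _ (measurableSet_singleton 0), smul_eq_mul, mul_one] at h1
  have h1' := ENNReal.tendsto_ofReal h1
  rw [ofReal_measureReal] at h1'
  have h2 : Tendsto (fun n : ℕ => EReal.exp
      (-(((x : ℝ≥0∞) * ENNReal.ofReal (ψ.cumulant t n) : ℝ≥0∞) : EReal))) atTop
      (𝓝 (EReal.exp (-(((x : ℝ≥0∞) * ψ.cumulantLimit t : ℝ≥0∞) : EReal)))) := by
    refine (continuous_exp_neg_coe.tendsto _).comp
      (ENNReal.Tendsto.const_mul ?_ (Or.inr ENNReal.coe_ne_top))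
    exact (tendsto_ofReal_cumulant t.2).comp tendsto_natCast_atTop_atTop
  refine tendsto_nhds_unique h1' (h2.congr fun n => ?_)
  have hc : 0 ≤ ψ.cumulant t n := cumulant_nonneg t.2
  rw [hP.laplace t x n n.cast_nonneg, ← ENNReal.ofReal_coe_nnreal,
    ← ENNReal.ofReal_mul x.coe_nonneg, EReal.coe_ennreal_ofReal,
    max_eq_left (mul_nonneg x.coe_nonneg hc), ← EReal.coe_neg, EReal.exp_coe]

/-! ### Absorption at zero -/

variable {Ω : Type*} {mΩ : MeasurableSpace Ω} {ℱ : Filtration ℝ≥0 mΩ} {X : ℝ≥0 → Ω → ℝ≥0}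
  {Q : ℝ≥0 → Measure Ω}

namespace IsCBRealization

lemma measurable (h : ψ.IsCBRealization ℱ X Q P) (t : ℝ≥0) : Measurable (X t) :=
  (h.adapted t).mono (ℱ.le t) le_rfl

/-- The Markov property as an identity of measures, on an event `A` of the past of `s`. -/
lemma map_restrict_eq_bind (h : ψ.IsCBRealization ℱ X Q P) (x s t : ℝ≥0) {A : Set Ω}
    (hA : MeasurableSet[ℱ s] A) :
    ((Q x).restrict A).map (X (s + t)) = (((Q x).restrict A).map (X s)).bind (P t) := by
  have := h.isProbabilityMeasure x
  have := h.semigroup.isMarkovKernel t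
  ext B hB
  have hXB : MeasurableSet (X (s + t) ⁻¹' B) := h.measurable _ hB
  have hmeas : Measurable fun y => P t y B := (P t).measurable_coe hB
  rw [Measure.map_apply (h.measurable _) hB, Measure.bind_apply hB (P t).aemeasurable,
    lintegral_map hmeas (h.measurable s)]
  have h1 := setIntegral_condExp (μ := Q x) (ℱ.le s)
    ((integrable_const (1 : ℝ)).indicator hXB) hA
  rw [setIntegral_congr_ae (ℱ.le s A hA) ((h.markov x s t B hB).mono fun ω hω _ => hω),
    integral_indicator_const _ hXB, smul_eq_mul, mul_one] at h1
  have h2 : ∀ ω, ENNReal.ofReal ((P t (X s ω)).real B) = P t (X s ω) B := fun ω =>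
    ofReal_measureReal
  have hint : Integrable (fun ω => (P t (X s ω)).real B) ((Q x).restrict A) := by
    refine (integrable_const (1 : ℝ)).mono'
      (hmeas.comp (h.measurable s)).ennreal_toReal.aestronglyMeasurable (ae_of_all _ fun ω => ?_)
    rw [Real.norm_of_nonneg measureReal_nonneg]
    exact measureReal_le_one
  simp_rw [← h2]
  rw [← ofReal_integral_eq_lintegral_ofReal hint (ae_of_all _ fun ω => measureReal_nonneg), h1,
    ofReal_measureReal]

lemma setLIntegral_one_sub_exp_le (h : ψ.IsCBRealization ℱ X Q P) (x : ℝ≥0) {s T : ℝ≥0}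
    (hs : s ≤ T) {A : Set Ω} (hA : MeasurableSet[ℱ s] A) :
    ∫⁻ ω in A, ENNReal.ofReal (1 - Real.exp (-(X T ω))) ∂(Q x)
      ≤ ∫⁻ ω in A, ENNReal.ofReal (X s ω * ψ.cumulant (T - s) 1) ∂(Q x) := by
  obtain ⟨t, rfl⟩ := exists_add_of_le hs
  have hg : Measurable fun y : ℝ≥0 => ENNReal.ofReal (1 - Real.exp (-(y : ℝ))) := by fun_prop
  rw [← lintegral_map hg (h.measurable (s + t)), h.map_restrict_eq_bind x s t hA,
    Measure.lintegral_bind (P t).aemeasurable hg.aemeasurable,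
    lintegral_map hg.lintegral_kernel (h.measurable s)]
  refine lintegral_mono fun ω => ?_
  simpa using h.semigroup.lintegral_one_sub_exp_le t (X s ω)

/-- A maximal inequality for the process `1 - exp (-X_s v_{T-s}(1))`, which is a martingale on
`[0, T]` ending in `1 - exp (-X_T)`: the event is split according to the first time in `D` at which
`X ≤ ε`, by adding the times in increasing order. -/
lemma withDensity_biUnion_le (h : ψ.IsCBRealization ℱ X Q P) (x T : ℝ≥0) {C : ℝ}
    (hC : ∀ t ∈ Icc (0 : ℝ) T, ψ.cumulant t 1 ≤ C) (ε : ℝ≥0) (D : Finset ℝ≥0)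
    (hD : ∀ d ∈ D, d ≤ T) :
    (Q x).withDensity (fun ω => ENNReal.ofReal (1 - Real.exp (-(X T ω))))
        (⋃ d ∈ D, {ω | X d ω ≤ ε})
      ≤ ENNReal.ofReal (ε * C) * Q x (⋃ d ∈ D, {ω | X d ω ≤ ε}) := by
  set ν := (Q x).withDensity (fun ω => ENNReal.ofReal (1 - Real.exp (-(X T ω))))
  have hle : ∀ d, MeasurableSet[ℱ d] {ω | X d ω ≤ ε} := fun d => h.adapted d measurableSet_Iic
  induction D using Finset.induction_on_max with
  | empty => simp
  | insert a D ha ih =>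
    have ih := ih fun d hd => hD d (Finset.mem_insert_of_mem hd)
    have haT : a ≤ T := hD a (Finset.mem_insert_self a D)
    set U := ⋃ d ∈ D, {ω | X d ω ≤ ε}
    have hU : MeasurableSet[ℱ a] U :=
      D.measurableSet_biUnion fun d hd => ℱ.mono (ha d hd).le _ (hle d)
    set V := {ω | X a ω ≤ ε} \ U
    have hV : MeasurableSet[ℱ a] V := (hle a).diff hU
    have hV' : MeasurableSet V := ℱ.le a _ hV
    have hUV : ⋃ d ∈ insert a D, {ω | X d ω ≤ ε} = U ∪ V := by
      rw [Finset.set_biUnion_insert, union_comm, union_sdiff_self]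
    have hdisj : Disjoint U V := disjoint_sdiff_right
    have hνV : ν V ≤ ENNReal.ofReal (ε * C) * Q x V := by
      rw [withDensity_apply _ hV']
      refine (h.setLIntegral_one_sub_exp_le x haT hV).trans ?_
      rw [← setLIntegral_const]
      refine setLIntegral_mono measurable_const fun ω hω => ENNReal.ofReal_le_ofReal ?_
      have h0 : (0 : ℝ) ≤ (T : ℝ) - a := sub_nonneg.2 haT
      have h1 := hC (T - a) ⟨h0, by linarith [a.2]⟩
      have h2 : 0 ≤ ψ.cumulant (T - a) 1 := cumulant_nonneg h0
      have h3 : (X a ω : ℝ) ≤ ε := hω.1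
      gcongr
    rw [hUV, measure_union hdisj hV', measure_union hdisj hV', mul_add]
    exact add_le_add ih hνV

lemma ae_eq_zero_of_lt (h : ψ.IsCBRealization ℱ X Q P) (x T : ℝ≥0) :
    ∀ᵐ ω ∂(Q x), (∃ s < T, X s ω = 0) → X T ω = 0 := by
  have := h.isProbabilityMeasure x
  obtain ⟨C, hC'⟩ :=
    (ψ.isCumulantSolution_cumulant zero_le_one).locally_bounded T T.2
  have hC : ∀ t ∈ Icc (0 : ℝ) T, ψ.cumulant t 1 ≤ C := fun t ht =>
    hC' (mem_image_of_mem _ ht)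
  set g : Ω → ℝ≥0∞ := fun ω => ENNReal.ofReal (1 - Real.exp (-(X T ω)))
  have hg : Measurable g := by
    have := h.measurable T
    fun_prop
  -- a countable dense set of times, cut off at `T`
  set d : ℕ → ℝ≥0 := fun n => min (TopologicalSpace.denseSeq ℝ≥0 n) T
  set E : ℝ≥0 → Set Ω := fun ε => ⋃ n, {ω | X (d n) ω ≤ ε}
  have hE : ∀ ε : ℝ≥0, (Q x).withDensity g (E ε) ≤ ENNReal.ofReal (ε * C) := by
    intro ε
    simp only [E]
    rw [measure_iUnion_eq_iSup_accumulate]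
    refine iSup_le fun n => ?_
    have e : accumulate (fun n => {ω | X (d n) ω ≤ ε}) n
        = ⋃ s ∈ (Finset.range (n + 1)).image d, {ω | X s ω ≤ ε} := by
      ext ω
      simp [mem_accumulate]
    rw [e]
    refine (h.withDensity_biUnion_le x T hC ε _ ?_).trans (mul_le_of_le_one_right' prob_le_one)
    simp [d]
  have hnull : (Q x).withDensity g (⋂ n : ℕ, E (1 / ((n : ℝ≥0) + 1))) = 0 := by
    have hlim : Tendsto (fun n : ℕ => ENNReal.ofReal (((1 / ((n : ℝ≥0) + 1) : ℝ≥0) : ℝ) * C))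
        atTop (𝓝 0) := by
      have := ENNReal.tendsto_ofReal
        ((tendsto_one_div_add_atTop_nhds_zero_nat (𝕜 := ℝ)).mul_const C)
      simpa using this
    refine le_antisymm (ge_of_tendsto' hlim fun n => ?_) bot_le
    exact (measure_mono (iInter_subset _ n)).trans (hE _)
  rw [withDensity_apply_eq_zero hg] at hnull
  filter_upwards [measure_eq_zero_iff_ae_notMem.1 hnull, h.cadlag x] with ω hω hcad
  rintro ⟨s, hsT, hs⟩
  by_contra hne
  refine hω ⟨?_, mem_iInter.2 fun n => ?_⟩
  · have : (0 : ℝ) < X T ω := NNReal.coe_pos.2 (pos_iff_ne_zero.2 hne)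
    simpa [g] using this
  -- by right-continuity at `s`, the path is small at dense times just after `s`
  have hε : (0 : ℝ≥0) < 1 / ((n : ℝ≥0) + 1) := by positivity
  have hev : ∀ᶠ r in 𝓝[≥] s, X r ω < 1 / ((n : ℝ≥0) + 1) := by
    refine (hcad s).1.eventually (gt_mem_nhds ?_)
    simpa only [hs] using hε
  obtain ⟨u, hu, hsub⟩ := (mem_nhdsGE_iff_exists_Ico_subset' hsT).1 hev
  obtain ⟨k, hk⟩ := (TopologicalSpace.denseRange_denseSeq ℝ≥0).exists_mem_open isOpen_Ioo
    (nonempty_Ioo.2 (lt_min (mem_Ioi.1 hu) hsT))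
  have hdk : d k = TopologicalSpace.denseSeq ℝ≥0 k :=
    min_eq_left (hk.2.trans_le (min_le_right _ _)).le
  refine mem_iUnion.2 ⟨k, ?_⟩
  have hlt : X (d k) ω < 1 / ((n : ℝ≥0) + 1) :=
    hsub ⟨by rw [hdk]; exact hk.1.le, by rw [hdk]; exact hk.2.trans_le (min_le_left _ _)⟩
  exact hlt.le

lemma ae_forall_eq_zero (h : ψ.IsCBRealization ℱ X Q P) (x : ℝ≥0) :
    ∀ᵐ ω ∂(Q x), ∀ n : ℕ, (∃ s < (n : ℝ≥0), X s ω = 0) → X n ω = 0 :=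
  ae_all_iff.2 fun n => h.ae_eq_zero_of_lt x n

lemma measure_eq_zero (h : ψ.IsCBRealization ℱ X Q P) (x t : ℝ≥0) :
    Q x {ω | X t ω = 0} = P t x {0} := by
  have := h.isProbabilityMeasure x
  have h1 := h.map_restrict_eq_bind x 0 t MeasurableSet.univ
  have h2 : (Q x).map (X 0) = Measure.dirac x := by
    rw [Measure.map_congr (h.start x), Measure.map_const]
    simp
  rw [Measure.restrict_univ, zero_add, h2, Measure.dirac_bind (P t).measurable] at h1
  rw [← h1, Measure.map_apply (h.measurable t) (measurableSet_singleton 0)]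
  rfl

lemma extinctionTime_lt_top_iff (ω : Ω) : extinctionTime X ω < ⊤ ↔ ∃ s, X s ω = 0 := by
  rw [extinctionTime, sInf_lt_iff]
  constructor
  · rintro ⟨_, ⟨s, hs, rfl⟩, -⟩
    exact ⟨s, hs⟩
  · rintro ⟨s, hs⟩
    exact ⟨_, ⟨s, hs, rfl⟩, ENNReal.coe_lt_top⟩

/-- Extinction is almost surely visible at integer times, since `0` is absorbing. -/
lemma extinction_ae_eq (h : ψ.IsCBRealization ℱ X Q P) (x : ℝ≥0) :
    {ω | extinctionTime X ω < ⊤} =ᵐ[Q x] ⋃ n : ℕ, {ω | X n ω = 0} := by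
  refine eventuallyEq_set.2 ?_
  filter_upwards [h.ae_forall_eq_zero x] with ω hω
  simp only [mem_ofPred_eq, mem_iUnion, extinctionTime_lt_top_iff]
  constructor
  · rintro ⟨s, hs⟩
    obtain ⟨n, hn⟩ := exists_nat_gt s
    exact ⟨n, hω n ⟨s, hn, hs⟩⟩
  · rintro ⟨n, hn⟩
    exact ⟨n, hn⟩

lemma nullMeasurableSet_extinction (h : ψ.IsCBRealization ℱ X Q P) (x : ℝ≥0) :
    NullMeasurableSet {ω | extinctionTime X ω < ⊤} (Q x) :=
  (MeasurableSet.iUnion fun n : ℕ =>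
    h.measurable n (measurableSet_singleton 0)).nullMeasurableSet.congr (h.extinction_ae_eq x).symm

/-- The extinction probability is the limit of `Q_x(X_n = 0) = exp (-x v̄_n)`. -/
lemma measure_extinction (h : ψ.IsCBRealization ℱ X Q P) (x : ℝ≥0) :
    Q x {ω | extinctionTime X ω < ⊤} =
      EReal.exp (-(((x : ℝ≥0∞) * ψ.extinctionRate : ℝ≥0∞) : EReal)) := by
  rw [measure_congr (h.extinction_ae_eq x)]
  have hacc : ∀ n : ℕ, Q x (accumulate (fun n : ℕ => {ω | X n ω = 0}) n) =
      EReal.exp (-(((x : ℝ≥0∞) * ψ.cumulantLimit (n : ℝ≥0) : ℝ≥0∞) : EReal)) := by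
    intro n
    rw [← h.semigroup.apply_singleton_zero n x, ← h.measure_eq_zero x n]
    refine measure_congr (eventuallyEq_set.2 ?_)
    filter_upwards [h.ae_forall_eq_zero x] with ω hω
    simp only [mem_accumulate, mem_ofPred_eq]
    refine ⟨fun ⟨k, hk, hk0⟩ => ?_, fun hn => ⟨n, le_rfl, hn⟩⟩
    rcases hk.lt_or_eq with hk | rfl
    · exact hω n ⟨k, Nat.cast_lt.2 hk, hk0⟩
    · exact hk0
  have h1 := tendsto_measure_iUnion_accumulate (μ := Q x) (f := fun n : ℕ => {ω | X n ω = 0})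
  simp only [hacc] at h1
  refine tendsto_nhds_unique h1 ?_
  refine (continuous_exp_neg_coe.tendsto _).comp
      (ENNReal.Tendsto.const_mul ?_ (Or.inr ENNReal.coe_ne_top))
  exact ψ.tendsto_cumulantLimit_coe.comp tendsto_natCast_atTop_atTop

end IsCBRealization

end BranchingMechanism

theorem theorem2p2p8 (ψ : BranchingMechanism) :
    ∃ (vbarAt : ℝ → ℝ≥0∞) (vbar : ℝ≥0∞),
      -- the increasing limits `v̄_t` in `l` and the decreasing limit `v̄` in `t`
      (∀ t, 0 ≤ t → MonotoneOn (fun l => ψ.cumulant t l) (Ici 0) ∧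
        Tendsto (fun l => ENNReal.ofReal (ψ.cumulant t l)) atTop (𝓝 (vbarAt t))) ∧
      AntitoneOn vbarAt (Ici 0) ∧
      Tendsto vbarAt atTop (𝓝 vbar) ∧
      -- the extinction probability is `exp (-x v̄)`, with `exp (-∞) = 0`
      (∀ (Ω : Type*) (mΩ : MeasurableSpace Ω) (ℱ : Filtration ℝ≥0 mΩ)
        (X : ℝ≥0 → Ω → ℝ≥0) (Q : ℝ≥0 → Measure Ω) (P : ℝ≥0 → Kernel ℝ≥0 ℝ≥0),
        ψ.IsCBRealization ℱ X Q P → ∀ x : ℝ≥0, 0 < x →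
          NullMeasurableSet {ω | extinctionTime X ω < ⊤} (Q x) ∧
          Q x {ω | extinctionTime X ω < ⊤} =
            EReal.exp (-(((x : ℝ≥0∞) * vbar : ℝ≥0∞) : EReal))) ∧
      -- finiteness of `v̄_t` for some, and then for all, `t > 0`
      ((∃ t, 0 < t ∧ vbarAt t < ⊤) ↔ ψ.GreyCondition) ∧
      ((∀ t, 0 < t → vbarAt t < ⊤) ↔ ψ.GreyCondition) ∧
      -- finiteness of `v̄`, which is then the largest root of `φ` in `[0, ∞)`
      (vbar < ⊤ ↔ ψ.GreyCondition) ∧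
      (vbar < ⊤ → IsGreatest {z : ℝ | 0 ≤ z ∧ ψ.phi z = 0} vbar.toReal) := by
  refine ⟨ψ.cumulantLimit, ψ.extinctionRate,
    fun t ht => ⟨(BranchingMechanism.monotone_cumulant ht).monotoneOn _,
      BranchingMechanism.tendsto_ofReal_cumulant ht⟩,
    ψ.antitoneOn_cumulantLimit, ψ.tendsto_cumulantLimit,
    fun Ω mΩ ℱ X Q P h x _ => ⟨h.nullMeasurableSet_extinction x, h.measure_extinction x⟩,
    ⟨fun ⟨t, ht, hlt⟩ => BranchingMechanism.greyCondition_of_cumulantLimit_lt_top ht.le hlt,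
      fun h => ⟨1, one_pos, h.cumulantLimit_lt_top one_pos⟩⟩,
    ⟨fun h => BranchingMechanism.greyCondition_of_cumulantLimit_lt_top zero_le_one (h 1 one_pos),
      fun h t ht => h.cumulantLimit_lt_top ht⟩,
    BranchingMechanism.extinctionRate_lt_top_iff,
    fun h => BranchingMechanism.isGreatest_extinctionRate
      (BranchingMechanism.extinctionRate_lt_top_iff.1 h)⟩
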